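/- Let $\xi$ be a real random variable with $\mathbb{E}\,\xi=0$ and $\operatorname{Var}\xi=1$ that is almost surely bounded. Then there exist constants $C,c_1,c_2>0$, depending only on the distribution of $\xi$, such that the following holds for every real $K$ with $\mathbb{P}(|\xi|\le K)=1$. For all integers $n\ge k\ge 1$, every deterministic $k$-dimensional linear subspace $V\subseteq\mathbb{R}^n$ with orthogonal projection $P_V:\mathbb{R}^n\to V\subseteq\mathbb{R}^n$, every random vector $\mathbf{c}=(x_1,\dots,x_n)$ whose entries $x_i$ are independent copies of $\xi$, and every $0<t<1/2$, $$\sup_{\mathbf{u}\in\mathbb{R}^n}\mathbb{P}\Big(\|P_V\mathbf{c}-\mathbf{u}\|_2\le t\sqrt{k}-c_1K\Big)\le C\exp(-c_2t^2k),$$ where $\|\cdot\|_2$ is the Euclidean norm. -/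

import Mathlib

open MeasureTheory ProbabilityTheory

/-! Maurey's property (τ) for convex functions. Let `f` be the distance from `P_V c` to `u`, and `κ
= 1 / (32 K²)` for coordinates in `[-K, K]`. If `g` is convex and `Qg` is its infimal convolution
with `κ|·|²`, then `E exp(Qg) * E exp(-g) ≤ 1`; convexity allows a constant free of the dimension.
Take `g = κ f²`. As `f` is 1-Lipschitz, `Qg ≥ κ f² / 2`. Jensen and `E f² ≥ k` bound `E exp(κ f² /
2)` below by `exp(κ k / 2)`, so `E exp(-κ f²) ≤ exp(-κ k / 2)`, and Markov gives `P(f ≤ r) ≤ exp(κ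
(r² - k / 2))`. No median or mean of `f` is needed. -/

open Set in
/-- The quadratic infimal convolution of `g` over the interval `[-K, K]`. -/
noncomputable def infConv (κ K : ℝ) (g : ℝ → ℝ) (x : ℝ) : ℝ :=
  sInf ((fun y => g y + κ * (x - y) ^ 2) '' Icc (-K) K)

/-! ### The one-dimensional inequality -/

section InfConv

open Set

variable {κ K : ℝ} {g : ℝ → ℝ}

lemma infConv_le (hg : Continuous g) (x : ℝ) {y : ℝ} (hy : y ∈ Icc (-K) K) :
    infConv κ K g x ≤ g y + κ * (x - y) ^ 2 :=
  csInf_le (isCompact_Icc.image (by fun_prop)).bddBelow (mem_image_of_mem _ hy)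

lemma exists_infConv_eq (hK : 0 ≤ K) (hg : Continuous g) (x : ℝ) :
    ∃ y ∈ Icc (-K) K, infConv κ K g x = g y + κ * (x - y) ^ 2 := by
  have hne : ((fun y => g y + κ * (x - y) ^ 2) '' Icc (-K) K).Nonempty :=
    (nonempty_Icc.2 (by linarith)).image _
  obtain ⟨y, hy, h⟩ := (isCompact_Icc.image (f := fun y => g y + κ * (x - y) ^ 2)
    (by fun_prop)).sInf_mem hne
  exact ⟨y, hy, h.symm⟩

lemma continuous_infConv (hg : Continuous g) : Continuous (infConv κ K g) :=
  isCompact_Icc.continuous_sInf (f := fun x y => g y + κ * (x - y) ^ 2) (by fun_prop)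

/-- Partial infimal convolution of a jointly convex function is convex in the other variable. -/
lemma convexOn_infConv {E : Type*} [AddCommGroup E] [Module ℝ E] (hκ : 0 ≤ κ) (hK : 0 ≤ K)
    {G : ℝ × E → ℝ} (hG : ConvexOn ℝ univ G) (hc : ∀ z, Continuous fun y => G (y, z)) (x : ℝ) :
    ConvexOn ℝ univ fun z => infConv κ K (fun y => G (y, z)) x := by
  refine ⟨convex_univ, fun z₁ _ z₂ _ a b ha hb hab => ?_⟩
  obtain ⟨y₁, hy₁, h₁⟩ := exists_infConv_eq (κ := κ) hK (hc z₁) x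
  obtain ⟨y₂, hy₂, h₂⟩ := exists_infConv_eq (κ := κ) hK (hc z₂) x
  have hy : a • y₁ + b • y₂ ∈ Icc (-K) K := convex_Icc _ _ hy₁ hy₂ ha hb hab
  have h := infConv_le (κ := κ) (hc (a • z₁ + b • z₂)) x hy
  have hG' := hG.2 (mem_univ (y₁, z₁)) (mem_univ (y₂, z₂)) ha hb hab
  simp only [Prod.smul_mk, Prod.mk_add_mk, smul_eq_mul] at hG' h ⊢
  rw [h₁, h₂]
  have hsq : (x - (a * y₁ + b * y₂)) ^ 2 ≤ a * (x - y₁) ^ 2 + b * (x - y₂) ^ 2 := by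
    obtain rfl : b = 1 - a := by linarith
    nlinarith [mul_nonneg (mul_nonneg ha hb) (sq_nonneg (y₁ - y₂))]
  nlinarith [mul_le_mul_of_nonneg_left hsq hκ]

/-- Used with `q = Qg - min g` and `v = g - min g`; `θ` is how far the trial point moves towards the
minimiser. The optimum is `θ = 4 * v`, or `θ = 1` once `v ≥ 1/4`. -/
lemma exp_add_exp_neg_le_two {q v : ℝ} (hv : 0 ≤ v)
    (hq : ∀ θ ∈ Icc (0 : ℝ) 1, q ≤ (1 - θ) * v + θ ^ 2 / 8) :
    Real.exp q + Real.exp (-v) ≤ 2 := by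
  have key : ∀ x : ℝ, |x| ≤ 1 → Real.exp x ≤ 1 + x + x ^ 2 := fun x hx => by
    have := (abs_le.1 (Real.abs_exp_sub_one_sub_id_le hx)).2
    linarith
  rcases le_total v (1 / 4) with h | h
  · have h₁ : q ≤ v - 2 * v ^ 2 := by
      have := hq (4 * v) ⟨by linarith, by linarith⟩
      nlinarith
    have h₂ := key (v - 2 * v ^ 2) (abs_le.2 ⟨by nlinarith, by nlinarith⟩)
    have h₃ := key (-v) (abs_le.2 ⟨by linarith, by linarith⟩)
    have h₄ := Real.exp_le_exp.2 h₁
    have h₅ : (v - 2 * v ^ 2) ^ 2 ≤ v ^ 2 :=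
      pow_le_pow_left₀ (by nlinarith) (by nlinarith) 2
    nlinarith
  · have h₁ := hq 1 ⟨by norm_num, le_rfl⟩
    have h₂ := key (1 / 8) (by norm_num [abs_le])
    have h₃ := key (-(1 / 4)) (by norm_num [abs_le])
    have h₄ : Real.exp q ≤ Real.exp (1 / 8) := Real.exp_le_exp.2 (by linarith)
    have h₅ : Real.exp (-v) ≤ Real.exp (-(1 / 4)) := Real.exp_le_exp.2 (by linarith)
    linarith

lemma Continuous.integrable_of_ae_mem_Icc {μ : Measure ℝ} [IsFiniteMeasure μ] {f : ℝ → ℝ}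
    (hf : Continuous f) (hμ : ∀ᵐ x ∂μ, x ∈ Icc (-K) K) : Integrable f μ := by
  obtain ⟨B, hB⟩ := isCompact_Icc.exists_bound_of_continuousOn (hf.continuousOn (s := Icc (-K) K))
  exact Integrable.of_bound hf.aestronglyMeasurable B (hμ.mono fun x hx => hB x hx)

/-- The convex infimal-convolution inequality (Maurey) on an interval. -/
lemma integral_exp_infConv_mul_le_one {μ : Measure ℝ} [IsProbabilityMeasure μ] (hK : 0 < K)
    (hμ : ∀ᵐ x ∂μ, x ∈ Icc (-K) K) (hg : ConvexOn ℝ univ g) (hgc : Continuous g) :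
    (∫ x, Real.exp (infConv (1 / (32 * K ^ 2)) K g x) ∂μ) * ∫ x, Real.exp (-g x) ∂μ ≤ 1 := by
  obtain ⟨x₀, hx₀, hmin⟩ := isCompact_Icc.exists_isMinOn
    (nonempty_Icc.2 (by linarith : -K ≤ K)) hgc.continuousOn
  set m := g x₀
  set Q := infConv (1 / (32 * K ^ 2)) K g
  have hQc : Continuous Q := continuous_infConv hgc
  have hpt : ∀ x ∈ Icc (-K) K,
      Real.exp (Q x) ≤ Real.exp m * (2 - Real.exp m * Real.exp (-g x)) := by
    intro x hx
    have hv : 0 ≤ g x - m := sub_nonneg.2 (hmin hx)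
    have h : Real.exp (Q x - m) + Real.exp (-(g x - m)) ≤ 2 := by
      refine exp_add_exp_neg_le_two hv fun θ hθ => ?_
      have hy : (1 - θ) • x + θ • x₀ ∈ Icc (-K) K :=
        convex_Icc _ _ hx hx₀ (by linarith [hθ.2]) hθ.1 (by ring)
      have h₁ : Q x ≤ _ := infConv_le (κ := 1 / (32 * K ^ 2)) hgc x hy
      have h₂ := hg.2 (mem_univ x) (mem_univ x₀) (by linarith [hθ.2] : 0 ≤ 1 - θ) hθ.1 (by ring)
      simp only [smul_eq_mul] at h₁ h₂
      -- The interval has length `2 * K`, which fixes the constant 32.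
      have h₃ : 1 / (32 * K ^ 2) * (x - ((1 - θ) * x + θ * x₀)) ^ 2 ≤ θ ^ 2 / 8 := by
        have h₄ : (x - x₀) ^ 2 ≤ (2 * K) ^ 2 :=
          sq_le_sq' (by linarith [hx.1, hx₀.2]) (by linarith [hx.2, hx₀.1])
        rw [one_div_mul_eq_div, div_le_div_iff₀ (by positivity) (by norm_num)]
        nlinarith [mul_le_mul_of_nonneg_left h₄ (sq_nonneg θ)]
      change g ((1 - θ) * x + θ * x₀) ≤ (1 - θ) * g x + θ * m at h₂
      linarith
    have e₁ : Real.exp (Q x) = Real.exp m * Real.exp (Q x - m) := by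
      rw [← Real.exp_add]; congr 1; ring
    have e₂ : Real.exp m * Real.exp (-g x) = Real.exp (-(g x - m)) := by
      rw [← Real.exp_add]; congr 1; ring
    rw [e₁, e₂]
    exact mul_le_mul_of_nonneg_left (by linarith) (Real.exp_pos _).le
  have hi : Integrable (fun x => Real.exp (-g x)) μ :=
    Continuous.integrable_of_ae_mem_Icc (by fun_prop) hμ
  have hle : ∫ x, Real.exp (Q x) ∂μ ≤
      Real.exp m * (2 - Real.exp m * ∫ x, Real.exp (-g x) ∂μ) := by
    calc _ ≤ ∫ x, Real.exp m * (2 - Real.exp m * Real.exp (-g x)) ∂μ :=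
          integral_mono_ae (Continuous.integrable_of_ae_mem_Icc (by fun_prop) hμ)
            (Continuous.integrable_of_ae_mem_Icc (by fun_prop) hμ) (hμ.mono hpt)
      _ = _ := by
          rw [integral_const_mul, integral_sub (integrable_const _) (hi.const_mul _),
            integral_const_mul]
          simp
  have hB : 0 ≤ ∫ x, Real.exp (-g x) ∂μ := integral_nonneg fun x => (Real.exp_pos _).le
  -- With `s = exp m * ∫ exp (-g)`, the product is at most `s * (2 - s) ≤ 1`.
  nlinarith [mul_le_mul_of_nonneg_right hle hB,
    sq_nonneg (Real.exp m * (∫ x, Real.exp (-g x) ∂μ) - 1)]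

end InfConv

/-! ### Tensorisation -/

/-- Hölder's inequality with weights `a`, `b`. It keeps the induction on dimension within convex
functions. -/
lemma convexOn_log_integral_exp {E α : Type*} [AddCommGroup E] [Module ℝ E] [MeasurableSpace α]
    {μ : Measure α} [NeZero μ] {h : E → α → ℝ}
    (hc : ∀ x, ConvexOn ℝ Set.univ fun y => h y x)
    (hi : ∀ y, Integrable (fun x => Real.exp (h y x)) μ) :
    ConvexOn ℝ Set.univ fun y => Real.log (∫ x, Real.exp (h y x) ∂μ) := by
  have hpos : ∀ y, 0 < ∫ x, Real.exp (h y x) ∂μ := fun y => integral_exp_pos (hi y)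
  have hI : ∀ y, ∫⁻ x, ENNReal.ofReal (Real.exp (h y x)) ∂μ
      = ENNReal.ofReal (∫ x, Real.exp (h y x) ∂μ) := fun y =>
    (ofReal_integral_eq_lintegral_ofReal (hi y)
      (Filter.Eventually.of_forall fun x => (Real.exp_pos _).le)).symm
  refine ⟨convex_univ, fun y₁ _ y₂ _ a b ha hb hab => ?_⟩
  have hle : ENNReal.ofReal (∫ x, Real.exp (h (a • y₁ + b • y₂) x) ∂μ) ≤
      ENNReal.ofReal ((∫ x, Real.exp (h y₁ x) ∂μ) ^ a * (∫ x, Real.exp (h y₂ x) ∂μ) ^ b) := by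
    rw [ENNReal.ofReal_mul (by positivity [hpos y₁]), ← ENNReal.ofReal_rpow_of_pos (hpos y₁),
      ← ENNReal.ofReal_rpow_of_pos (hpos y₂), ← hI, ← hI, ← hI]
    refine le_trans (lintegral_mono fun x => ?_) (ENNReal.lintegral_mul_norm_pow_le
      (hi y₁).aestronglyMeasurable.aemeasurable.ennreal_ofReal
      (hi y₂).aestronglyMeasurable.aemeasurable.ennreal_ofReal ha hb hab)
    rw [ENNReal.ofReal_rpow_of_pos (Real.exp_pos _), ENNReal.ofReal_rpow_of_pos (Real.exp_pos _),
      ← ENNReal.ofReal_mul (by positivity), ← Real.exp_mul, ← Real.exp_mul, ← Real.exp_add]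
    refine ENNReal.ofReal_le_ofReal (Real.exp_le_exp.2 ?_)
    have := (hc x).2 (Set.mem_univ y₁) (Set.mem_univ y₂) ha hb hab
    simp only [smul_eq_mul] at this
    linarith
  have h₁ := hpos y₁
  have h₂ := hpos y₂
  rw [ENNReal.ofReal_le_ofReal_iff (by positivity)] at hle
  calc _ ≤ Real.log ((∫ x, Real.exp (h y₁ x) ∂μ) ^ a * (∫ x, Real.exp (h y₂ x) ∂μ) ^ b) :=
        Real.log_le_log (hpos _) hle
    _ = _ := by
        rw [Real.log_mul (by positivity) (by positivity), Real.log_rpow h₁, Real.log_rpow h₂]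
        rfl

lemma lintegral_pi_fin_succ {n : ℕ} (μ : Measure ℝ) [SigmaFinite μ]
    {H : (Fin (n + 1) → ℝ) → ENNReal} (hH : Measurable H) :
    ∫⁻ x, H x ∂Measure.pi (fun _ => μ) =
      ∫⁻ y, ∫⁻ x, H (Fin.cons x y) ∂μ ∂Measure.pi (fun _ : Fin n => μ) := by
  have e := (measurePreserving_piFinSuccAbove (fun _ : Fin (n + 1) => μ) 0).symm
  have hm : Measurable fun p => H ((MeasurableEquiv.piFinSuccAbove (fun _ => ℝ) 0).symm p) :=
    hH.comp (MeasurableEquiv.measurable _)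
  rw [← e.lintegral_comp hH, lintegral_prod_symm _ hm.aemeasurable]
  simp [MeasurableEquiv.piFinSuccAbove, Fin.insertNthEquiv]

/-- The convex infimal-convolution inequality for product measures supported in a cube. -/
theorem lintegral_mul_lintegral_exp_neg_le_one {K : ℝ} (hK : 0 < K) {μ : Measure ℝ}
    [IsProbabilityMeasure μ] (hμ : ∀ᵐ x ∂μ, x ∈ Set.Icc (-K) K) (n : ℕ)
    {g : (Fin n → ℝ) → ℝ} (hg : ConvexOn ℝ Set.univ g) {F : (Fin n → ℝ) → ENNReal}
    (hF : Measurable F) (hFg : ∀ x y, F x ≤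
      ENNReal.ofReal (Real.exp (g y + 1 / (32 * K ^ 2) * ∑ i, (x i - y i) ^ 2))) :
    (∫⁻ x, F x ∂Measure.pi (fun _ => μ)) *
      ∫⁻ x, ENNReal.ofReal (Real.exp (-g x)) ∂Measure.pi (fun _ => μ) ≤ 1 := by
  induction n with
  | zero =>
    rw [lintegral_unique, lintegral_unique]
    simp only [measure_univ, mul_one]
    refine (mul_le_mul_left (hFg _ default) _).trans ?_
    rw [← ENNReal.ofReal_mul (Real.exp_pos _).le, ← Real.exp_add]
    simp only [Finset.univ_eq_empty, Finset.sum_empty, mul_zero, add_zero]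
    rw [Subsingleton.elim (default : Fin 0 → ℝ) (@default _ Unique.instInhabited)]
    simp
  | succ n ih =>
    set κ := 1 / (32 * K ^ 2) with hκ
    have hκ0 : 0 ≤ κ := by positivity
    have hgc : Continuous g := continuousOn_univ.1 (hg.continuousOn isOpen_univ)
    set G : ℝ × (Fin n → ℝ) → ℝ := fun p => g (Fin.cons p.1 p.2) with hGdef
    have hG : ConvexOn ℝ Set.univ G := by
      have := hg.comp_linearMap (Fin.consLinearEquiv ℝ (fun _ : Fin (n + 1) => ℝ)).toLinearMap
      exact this
    have hGc : ∀ z, Continuous fun y => G (y, z) := fun z =>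
      hgc.comp (by fun_prop)
    have hGx : ∀ z, ConvexOn ℝ Set.univ fun y => G (y, z) := fun z =>
      ⟨convex_univ, fun y₁ _ y₂ _ a b ha hb hab => by
        have := hG.2 (Set.mem_univ (y₁, z)) (Set.mem_univ (y₂, z)) ha hb hab
        rwa [Prod.smul_mk, Prod.smul_mk, Prod.mk_add_mk, ← add_smul, hab, one_smul] at this⟩
    set Q : (Fin n → ℝ) → ℝ → ℝ := fun z => infConv κ K fun y => G (y, z) with hQdef
    have hQi : ∀ z, Integrable (fun x => Real.exp (Q z x)) μ := fun z =>
      Continuous.integrable_of_ae_mem_Icc ((continuous_infConv (hGc z)).rexp) hμ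
    -- `φ` replaces `g` in dimension `n`: the inequality on each fibre bounds `∫ exp (-g)` by `exp
    -- (-φ)`, and integrating `F` over the first coordinate preserves the hypothesis `hFg`.
    set φ : (Fin n → ℝ) → ℝ := fun z => Real.log (∫ x, Real.exp (Q z x) ∂μ) with hφdef
    have hφ : ConvexOn ℝ Set.univ φ :=
      convexOn_log_integral_exp (fun x => convexOn_infConv hκ0 hK.le hG hGc x) hQi
    have hφexp : ∀ z, Real.exp (φ z) = ∫ x, Real.exp (Q z x) ∂μ := fun z =>
      Real.exp_log (integral_exp_pos (hQi z))
    have hcons : Measurable fun p : (Fin n → ℝ) × ℝ =>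
        (Fin.cons p.2 p.1 : Fin (n + 1) → ℝ) :=
      (by fun_prop : Continuous fun p : (Fin n → ℝ) × ℝ =>
        (Fin.cons p.2 p.1 : Fin (n + 1) → ℝ)).measurable
    rw [lintegral_pi_fin_succ μ hF, lintegral_pi_fin_succ μ (by fun_prop)]
    have hW : Measurable fun y => ∫⁻ x, F (Fin.cons x y) ∂μ :=
      Measurable.lintegral_prod_right' (f := fun p : (Fin n → ℝ) × ℝ => F (Fin.cons p.2 p.1))
        (hF.comp hcons)
    refine le_trans (mul_le_mul_right (lintegral_mono fun y => ?_) _) (ih hφ hW fun y z => ?_)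
    · have h := integral_exp_infConv_mul_le_one hK hμ (hGx y) (hGc y)
      change (∫ x, Real.exp (Q y x) ∂μ) * ∫ x, Real.exp (-G (x, y)) ∂μ ≤ 1 at h
      rw [← hφexp] at h
      have hi : Integrable (fun x => Real.exp (-G (x, y))) μ :=
        Continuous.integrable_of_ae_mem_Icc ((hGc y).neg.rexp) hμ
      change ∫⁻ x, ENNReal.ofReal (Real.exp (-G (x, y))) ∂μ ≤ _
      rw [← ofReal_integral_eq_lintegral_ofReal hi
        (Filter.Eventually.of_forall fun x => (Real.exp_pos _).le)]
      refine ENNReal.ofReal_le_ofReal ?_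
      rw [Real.exp_neg, ← one_div, le_div_iff₀ (Real.exp_pos _), mul_comm]
      exact h
    · rw [Real.exp_add, hφexp, ENNReal.ofReal_mul (integral_exp_pos (hQi z)).le,
        ofReal_integral_eq_lintegral_ofReal (hQi z)
        (Filter.Eventually.of_forall fun x => (Real.exp_pos _).le),
        ← lintegral_mul_const' _ _ ENNReal.ofReal_ne_top]
      refine lintegral_mono fun x => ?_
      obtain ⟨y₀, -, h₀⟩ := exists_infConv_eq (κ := κ) hK.le (hGc z) x
      change Q z x = _ at h₀
      rw [← ENNReal.ofReal_mul (Real.exp_pos _).le, ← Real.exp_add, h₀]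
      refine (hFg (Fin.cons x y) (Fin.cons y₀ z)).trans_eq ?_
      simp only [Fin.sum_univ_succ, Fin.cons_zero, Fin.cons_succ, hGdef]
      congr 2
      ring

/-! ### Lower tail of the projection -/

/-- The expected squared distance of the projection of an isotropic vector from a fixed point is at
least the dimension of the subspace. -/
lemma finrank_le_integral_norm_starProjection_sub_sq {Ω : Type*} [MeasurableSpace Ω]
    {P : Measure Ω} [IsProbabilityMeasure P] {n : ℕ} {x : Fin n → Ω → ℝ}
    (hx : iIndepFun x P) (hL : ∀ i, MemLp (x i) 2 P) (hvar : ∀ i, variance (x i) P = 1)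
    (V : Submodule ℝ (EuclideanSpace ℝ (Fin n))) (u : EuclideanSpace ℝ (Fin n))
    (hi : Integrable (fun ω => ‖V.starProjection (WithLp.toLp 2 fun i => x i ω) - u‖ ^ 2) P) :
    (Module.finrank ℝ V : ℝ) ≤
      ∫ ω, ‖V.starProjection (WithLp.toLp 2 fun i => x i ω) - u‖ ^ 2 ∂P := by
  set b := stdOrthonormalBasis ℝ V
  set v : Fin (Module.finrank ℝ V) → EuclideanSpace ℝ (Fin n) := fun j => b j
  have hv : Orthonormal ℝ v := b.orthonormal.comp_linearIsometry V.subtypeₗᵢ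
  have hsum : ∀ j, (fun ω => inner ℝ (v j) (WithLp.toLp 2 fun i => x i ω))
      = ∑ i, fun ω => v j i * x i ω := fun j => by
    ext ω
    simp [PiLp.inner_apply, mul_comm]
  have hLs : ∀ j i, MemLp (fun ω => v j i * x i ω) 2 P := fun j i => (hL i).const_mul _
  have hLj : ∀ j, MemLp (fun ω => inner ℝ (v j) (WithLp.toLp 2 fun i => x i ω)) 2 P := fun j => by
    rw [hsum]
    exact memLp_finsetSum' _ fun i _ => hLs j i
  have hvarj : ∀ j,
      variance (fun ω => inner ℝ (v j) (WithLp.toLp 2 fun i => x i ω)) P = 1 := fun j => by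
    rw [hsum, IndepFun.variance_sum (fun i _ => hLs j i)]
    · simp only [variance_const_mul, hvar, mul_one]
      have := hv.1 j
      rw [EuclideanSpace.norm_eq, Real.sqrt_eq_one] at this
      simpa using this
    · intro i _ k _ hik
      exact (hx.indepFun hik).comp (measurable_const_mul (v j i)) (measurable_const_mul (v j k))
  have hLc : ∀ j, MemLp (fun ω => inner ℝ (v j) (WithLp.toLp 2 fun i => x i ω) - inner ℝ (v j) u)
      2 P := fun j => (hLj j).sub (memLp_const _)
  -- A second moment about any point is at least the variance.
  have hone : ∀ j, 1 ≤ ∫ ω, (inner ℝ (v j) (WithLp.toLp 2 fun i => x i ω)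
      - inner ℝ (v j) u) ^ 2 ∂P := fun j => by
    rw [← hvarj j, ← variance_sub_const (hLj j).aestronglyMeasurable (inner ℝ (v j) u)]
    exact variance_le_expectation_sq (hLc j).aestronglyMeasurable
  calc (Module.finrank ℝ V : ℝ) = ∑ _j : Fin (Module.finrank ℝ V), (1 : ℝ) := by simp
    _ ≤ ∑ j, ∫ ω, (inner ℝ (v j) (WithLp.toLp 2 fun i => x i ω) - inner ℝ (v j) u) ^ 2 ∂P :=
        Finset.sum_le_sum fun j _ => hone j
    _ = ∫ ω, ∑ j, (inner ℝ (v j) (WithLp.toLp 2 fun i => x i ω) - inner ℝ (v j) u) ^ 2 ∂P :=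
        (integral_finsetSum _ fun j _ => (hLc j).integrable_sq).symm
    -- Bessel's inequality for the `v j`, which the projection fixes.
    _ ≤ _ := by
        refine integral_mono (integrable_finsetSum _ fun j _ => (hLc j).integrable_sq) hi
          fun ω => ?_
        refine le_trans (Finset.sum_le_sum fun j _ => le_of_eq ?_)
          (hv.sum_inner_products_le (s := Finset.univ) _)
        have hmem : v j ∈ V := (b j).2
        rw [inner_sub_right, ← V.inner_starProjection_left_eq_right,
          Submodule.starProjection_eq_self_iff.2 hmem, Real.norm_eq_abs, sq_abs]

/-- Lower tail of the distance from a fixed point to the projection of a vector with independent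
bounded coordinates. -/
theorem measure_norm_starProjection_sub_le {Ω : Type*} [MeasurableSpace Ω] {P : Measure Ω}
    [IsProbabilityMeasure P] {μ : Measure ℝ} [IsProbabilityMeasure μ] {K : ℝ} (hK : 0 < K)
    (hμ : ∀ᵐ x ∂μ, x ∈ Set.Icc (-K) K) {n : ℕ} {x : Fin n → Ω → ℝ} (hx : iIndepFun x P)
    (hxm : ∀ i, AEMeasurable (x i) P) (hlaw : ∀ i, P.map (x i) = μ)
    (hvar : ∀ i, variance (x i) P = 1) (V : Submodule ℝ (EuclideanSpace ℝ (Fin n)))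
    (u : EuclideanSpace ℝ (Fin n)) (r : ℝ) :
    P {ω | ‖V.starProjection (WithLp.toLp 2 fun i => x i ω) - u‖ ≤ r} ≤
      ENNReal.ofReal (Real.exp (1 / (32 * K ^ 2) * (r ^ 2 - Module.finrank ℝ V / 2))) := by
  set κ := 1 / (32 * K ^ 2) with hκ
  have hκ0 : 0 < κ := by positivity
  set f : (Fin n → ℝ) → ℝ := fun y => ‖V.starProjection (WithLp.toLp 2 y) - u‖ with hf
  have hfc : Continuous f := by
    have : Continuous fun y : Fin n → ℝ => WithLp.toLp 2 y := PiLp.continuous_toLp 2 _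
    fun_prop
  set X : Ω → Fin n → ℝ := fun ω i => x i ω with hXdef
  have hX : AEMeasurable X P := aemeasurable_pi_lambda _ hxm
  have hXlaw : P.map X = Measure.pi fun _ => μ := by
    rw [(iIndepFun_iff_map_fun_eq_pi_map hxm).1 hx]
    simp only [hlaw]
  have hXK : ∀ᵐ ω ∂P, ∀ i, x i ω ∈ Set.Icc (-K) K := ae_all_iff.2 fun i => by
    rw [← hlaw i] at hμ
    exact ae_of_ae_map (hxm i) hμ
  have hbdd : ∀ h : (Fin n → ℝ) → ℝ, Continuous h → Integrable (fun ω => h (X ω)) P := by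
    intro h hc
    obtain ⟨B, hB⟩ := (isCompact_univ_pi fun _ : Fin n => isCompact_Icc (a := -K) (b := K)
      ).exists_bound_of_continuousOn hc.continuousOn
    exact Integrable.of_bound (hc.measurable.comp_aemeasurable hX).aestronglyMeasurable B
      (hXK.mono fun ω hω => hB _ fun i _ => hω i)
  have hg : ConvexOn ℝ Set.univ fun y => κ * f y ^ 2 := by
    have h₁ : ConvexOn ℝ Set.univ f := by
      have h₂ : ConvexOn ℝ Set.univ fun z : EuclideanSpace ℝ (Fin n) => ‖z - u‖ := by
        simpa only [dist_eq_norm] using convexOn_dist u convex_univ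
      exact h₂.comp_linearMap
        (V.starProjection.toLinearMap ∘ₗ (WithLp.linearEquiv 2 ℝ (Fin n → ℝ)).symm.toLinearMap)
    exact (h₁.pow (fun y _ => norm_nonneg _) 2).smul hκ0.le
  have htau := lintegral_mul_lintegral_exp_neg_le_one hK hμ n hg
    (F := fun y => ENNReal.ofReal (Real.exp (κ / 2 * f y ^ 2))) (by fun_prop) fun y z => by
      refine ENNReal.ofReal_le_ofReal (Real.exp_le_exp.2 ?_)
      have h₁ : f y ≤ f z + ‖WithLp.toLp 2 y - WithLp.toLp 2 z‖ := by
        have h₂ : V.starProjection (WithLp.toLp 2 y) - u = (V.starProjection (WithLp.toLp 2 z) - u)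
            + V.starProjection (WithLp.toLp 2 y - WithLp.toLp 2 z) := by
          rw [map_sub]; abel
        change ‖_‖ ≤ _
        rw [h₂]
        exact (norm_add_le _ _).trans (add_le_add_right (V.norm_starProjection_apply_le _) _)
      have h₃ : ‖(WithLp.toLp 2 y - WithLp.toLp 2 z : EuclideanSpace ℝ (Fin n))‖ ^ 2
          = ∑ i, (y i - z i) ^ 2 := by
        rw [EuclideanSpace.norm_sq_eq]
        simp
      rw [← hκ, ← h₃]
      have h₄ : f y ^ 2 ≤ (f z + ‖WithLp.toLp 2 y - WithLp.toLp 2 z‖) ^ 2 :=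
        pow_le_pow_left₀ (norm_nonneg _) h₁ 2
      have h₅ : f y ^ 2 ≤ 2 * f z ^ 2 + 2 * ‖WithLp.toLp 2 y - WithLp.toLp 2 z‖ ^ 2 := by
        nlinarith [sq_nonneg (f z - ‖WithLp.toLp 2 y - WithLp.toLp 2 z‖)]
      nlinarith [mul_le_mul_of_nonneg_left h₅ hκ0.le]
  rw [← hXlaw, lintegral_map' (by fun_prop) hX, lintegral_map' (by fun_prop) hX] at htau
  have hlow : ENNReal.ofReal (Real.exp (κ / 2 * Module.finrank ℝ V)) ≤
      ∫⁻ ω, ENNReal.ofReal (Real.exp (κ / 2 * f (X ω) ^ 2)) ∂P := by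
    rw [← ofReal_integral_eq_lintegral_ofReal (hbdd (fun y => Real.exp (κ / 2 * f y ^ 2))
      (by fun_prop)) (Filter.Eventually.of_forall fun ω => (Real.exp_pos _).le)]
    refine ENNReal.ofReal_le_ofReal ?_
    have hJ := convexOn_exp.map_integral_le (μ := P) (f := fun ω => κ / 2 * f (X ω) ^ 2)
      Real.continuous_exp.continuousOn isClosed_univ (Filter.Eventually.of_forall fun _ => trivial)
      (hbdd (fun y => κ / 2 * f y ^ 2) (by fun_prop))
      (hbdd (fun y => Real.exp (κ / 2 * f y ^ 2)) (by fun_prop))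
    refine le_trans (Real.exp_le_exp.2 ?_) hJ
    rw [integral_const_mul]
    refine mul_le_mul_of_nonneg_left ?_ (by positivity)
    refine finrank_le_integral_norm_starProjection_sub_sq hx (fun i => ?_) hvar V u
      (hbdd (fun y => f y ^ 2) (by fun_prop))
    exact MemLp.of_bound (hxm i).aestronglyMeasurable K
      (hXK.mono fun ω hω => abs_le.2 (hω i))
  set S := {ω | ‖V.starProjection (WithLp.toLp 2 fun i => x i ω) - u‖ ≤ r}
  have hmarkov : ENNReal.ofReal (Real.exp (-(κ * r ^ 2))) * P S ≤
      ∫⁻ ω, ENNReal.ofReal (Real.exp (-(κ * f (X ω) ^ 2))) ∂P := by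
    refine le_trans (mul_le_mul_right (measure_mono fun ω hω => ?_) _)
      (mul_meas_ge_le_lintegral₀ ((by fun_prop : Measurable fun y : Fin n → ℝ =>
        ENNReal.ofReal (Real.exp (-(κ * f y ^ 2)))).comp_aemeasurable hX) _)
    refine ENNReal.ofReal_le_ofReal (Real.exp_le_exp.2 (neg_le_neg ?_))
    exact mul_le_mul_of_nonneg_left (pow_le_pow_left₀ (norm_nonneg _) hω 2) hκ0.le
  have hprod := (mul_le_mul' hlow hmarkov).trans htau
  rw [← mul_assoc, ← ENNReal.ofReal_mul (Real.exp_pos _).le, ← Real.exp_add] at hprod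
  have hfin : κ * (r ^ 2 - Module.finrank ℝ V / 2)
      = -(κ / 2 * Module.finrank ℝ V + -(κ * r ^ 2)) := by ring
  rw [hfin, Real.exp_neg, ENNReal.ofReal_inv_of_pos (Real.exp_pos _),
    ENNReal.le_inv_iff_mul_le, mul_comm]
  exact hprod

theorem theorem2p7 {Ω₀ : Type*} [MeasurableSpace Ω₀] (P₀ : Measure Ω₀) [IsProbabilityMeasure P₀]
    (ξ : Ω₀ → ℝ) (hξ : AEMeasurable ξ P₀)
    (hmean : ∫ ω, ξ ω ∂P₀ = 0) (hvar : variance ξ P₀ = 1) :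
    ∃ C c₁ c₂ : ℝ, 0 < C ∧ 0 < c₁ ∧ 0 < c₂ ∧
      ∀ K : ℝ, (∀ᵐ ω ∂P₀, |ξ ω| ≤ K) →
      ∀ (n k : ℕ), 1 ≤ k →
      ∀ V : Submodule ℝ (EuclideanSpace ℝ (Fin n)), Module.finrank ℝ V = k →
      ∀ (Ω : Type*) [MeasurableSpace Ω] (P : Measure Ω) [IsProbabilityMeasure P]
        (x : Fin n → Ω → ℝ), iIndepFun x P → (∀ i, IdentDistrib (x i) ξ P P₀) →
      ∀ t : ℝ, 0 < t → t < 1 / 2 →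
        (⨆ u : EuclideanSpace ℝ (Fin n),
          P {ω | ‖V.starProjection (WithLp.toLp 2 (fun i => x i ω)) - u‖
            ≤ t * Real.sqrt k - c₁ * K})
          ≤ ENNReal.ofReal (C * Real.exp (-c₂ * t ^ 2 * k)) := by
  by_cases hbdd : ∃ K : ℝ, ∀ᵐ ω ∂P₀, |ξ ω| ≤ K
  swap
  · exact ⟨1, 1, 1, one_pos, one_pos, one_pos, fun K hK => (hbdd ⟨K, hK⟩).elim⟩
  obtain ⟨K₀, hK₀⟩ := hbdd
  set L := max K₀ 1
  have hL : 0 < L := lt_of_lt_of_le one_pos (le_max_right _ _)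
  -- `L` comes from one fixed bound on `ξ`, since the constants precede `K`; the term `c₁ * K ≥ 0`
  -- is simply discarded.
  refine ⟨1, 1, 1 / (32 * L ^ 2), one_pos, one_pos, by positivity, ?_⟩
  intro K hK n k _ V hV Ω _ P _ x hx hid t ht ht2
  have : IsProbabilityMeasure (P₀.map ξ) := Measure.isProbabilityMeasure_map hξ
  have hμ : ∀ᵐ y ∂P₀.map ξ, y ∈ Set.Icc (-L) L :=
    (ae_map_iff hξ measurableSet_Icc).2
      (hK₀.mono fun ω hω => abs_le.1 (hω.trans (le_max_left _ _)))
  have hK0 : 0 ≤ K := by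
    obtain ⟨ω, hω⟩ := hK.exists
    exact (abs_nonneg _).trans hω
  refine iSup_le fun u => ?_
  have h := measure_norm_starProjection_sub_le hL hμ hx (fun i => (hid i).aemeasurable_fst)
    (fun i => (hid i).map_eq) (fun i => (hid i).variance_eq.trans hvar) V u
    (t * Real.sqrt k)
  refine (measure_mono fun ω hω => ?_).trans (h.trans (ENNReal.ofReal_le_ofReal ?_))
  · have hω' : ‖V.starProjection (WithLp.toLp 2 fun i => x i ω) - u‖ ≤ t * √k - 1 * K := hω
    exact hω'.trans (by linarith)
  · rw [one_mul, hV, mul_pow, Real.sq_sqrt (Nat.cast_nonneg k), neg_mul, neg_mul, ← mul_neg_one,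
      mul_assoc, mul_assoc]
    refine Real.exp_le_exp.2 (mul_le_mul_of_nonneg_left ?_ (by positivity))
    -- `t < 1/2` gives `t² - 1/2 ≤ -t²`.
    nlinarith [mul_nonneg (Nat.cast_nonneg (α := ℝ) k) (by nlinarith : (0 : ℝ) ≤ 1 / 2 - 2 * t ^ 2)]
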